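/- Let $0<a<1$, let $\phi(x)=\frac{1}{\sqrt{2\pi}}e^{-x^2/2}$, and let $T_a$ be the integral operator on the complex space $L^1(\mathbb{R})$ given by $$T_a[f](y)=\int_{-\infty}^{\infty}\operatorname{sign}(x-ay)\,\phi(y-x)\,f(x)\,dx,\qquad y\in\mathbb{R},$$ with null space $\mathcal{N}_{L^1}(T_a)=\{f\in L^1(\mathbb{R}) : T_a[f]=0\}$. For $\mu,\omega\in\mathbb{R}$ and $\sigma^2>0$ let $f_{\mu,\sigma^2,\omega}(x)=\exp\left(-\frac{(x-\mu)^2}{2\sigma^2}\right)e^{i\omega x}$ be the Gabor wavelet, and let $\mathrm{erf}(z)=\frac{2}{\sqrt{\pi}}\int_0^z e^{-w^2}\,dw$ for $z\in\mathbb{C}$. **Theorem.** The complex vector space $\mathcal{N}_{L^1}(T_a)$ is infinite-dimensional. Moreover, let $G_a$ be the set of Gabor wavelets $f_{\mu,\frac{a}{1-a},\omega}$ with $\mu,\omega\in\mathbb{R}$ such that $$\frac{1}{\sqrt{2}}\left(\frac{1-a}{\sqrt{a}}\,\mu+i\sqrt{a}\,\omega\right)$$ is a zero of $\mathrm{erf}$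 in $\mathbb{C}$. Then $G_a$ is infinite and $\operatorname{span}_{\mathbb{C}}(G_a)\subseteq\mathcal{N}_{L^1}(T_a)$. -/

import Mathlib

open MeasureTheory

noncomputable section

namespace LinearMedian

/-- The complex error function `erf z = (2 / √π) ∫₀ᶻ exp (-w²) dw`, the integral being taken along
the segment `w = t z`, `0 ≤ t ≤ 1` (the integrand is entire, so the path is irrelevant). -/
def erf (z : ℂ) : ℂ :=
  (2 / (Real.sqrt Real.pi : ℂ)) * ∫ t in (0 : ℝ)..1, Complex.exp (-((t : ℂ) * z) ^ 2) * z

/-- The kernel `K_a(x, y) = sign(x - a y) φ(y - x)`, with `φ` the standard Gaussian density. -/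
def kernel (a x y : ℝ) : ℝ :=
  Real.sign (x - a * y) * ProbabilityTheory.gaussianPDFReal 0 1 (y - x)

theorem measurable_kernel (a y : ℝ) : Measurable fun x => kernel a x y := by
  have hs : Measurable Real.sign := by
    unfold Real.sign
    exact Measurable.ite measurableSet_Iio measurable_const
      (Measurable.ite measurableSet_Ioi measurable_const measurable_const)
  exact (hs.comp (measurable_id.sub_const _)).mul
    ((ProbabilityTheory.measurable_gaussianPDFReal 0 1).comp (measurable_const.sub measurable_id))

theorem norm_kernel_le (a x y : ℝ) : ‖(kernel a x y : ℂ)‖ ≤ (Real.sqrt (2 * Real.pi))⁻¹ := by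
  have h1 : |Real.sign (x - a * y)| ≤ 1 := by
    rcases Real.sign_apply_eq (x - a * y) with h | h | h <;> simp [h]
  have h2 : |ProbabilityTheory.gaussianPDFReal 0 1 (y - x)| ≤ (Real.sqrt (2 * Real.pi))⁻¹ := by
    rw [abs_of_nonneg (ProbabilityTheory.gaussianPDFReal_nonneg _ _ _),
      ProbabilityTheory.gaussianPDFReal]
    simp only [NNReal.coe_one, mul_one]
    refine mul_le_of_le_one_right (by positivity) (Real.exp_le_one_iff.2 ?_)
    have := sq_nonneg (y - x - 0)
    linarith
  rw [Complex.norm_real, Real.norm_eq_abs, kernel, abs_mul]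
  calc _ ≤ 1 * (Real.sqrt (2 * Real.pi))⁻¹ :=
        mul_le_mul h1 h2 (abs_nonneg _) zero_le_one
    _ = _ := one_mul _

theorem integrable_kernel_mul (a y : ℝ) {f : ℝ → ℂ} (hf : Integrable f) :
    Integrable fun x => (kernel a x y : ℂ) * f x :=
  hf.bdd_mul (Complex.measurable_ofReal.comp (measurable_kernel a y)).aestronglyMeasurable
    (Filter.Eventually.of_forall fun x => norm_kernel_le a x y)

/-- The integral operator `T_a[f](y) = ∫ K_a(x, y) f(x) dx` on complex `L¹(ℝ)`. The integral
converges and is independent of the representative of `f` for every `y`, so `T_a[f]` is a genuine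
function of `y`. -/
def T (a : ℝ) : Lp ℂ 1 (volume : Measure ℝ) →ₗ[ℂ] (ℝ → ℂ) where
  toFun f := fun y => ∫ x, (kernel a x y : ℂ) * f x
  map_add' f g := by
    funext y
    rw [Pi.add_apply, ← integral_add (integrable_kernel_mul a y (L1.integrable_coeFn f))
      (integrable_kernel_mul a y (L1.integrable_coeFn g))]
    refine integral_congr_ae ?_
    filter_upwards [Lp.coeFn_add f g] with x hx
    rw [hx, Pi.add_apply, mul_add]
  map_smul' c f := by
    funext y
    rw [RingHom.id_apply, Pi.smul_apply, smul_eq_mul, ← integral_const_mul]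
    refine integral_congr_ae ?_
    filter_upwards [Lp.coeFn_smul c f] with x hx
    rw [hx, Pi.smul_apply, smul_eq_mul, mul_left_comm]

/-- The null space `N_{L¹}(T_a) = {f ∈ L¹(ℝ) : T_a[f] = 0}`. -/
def nullSpace (a : ℝ) : Submodule ℂ (Lp ℂ 1 (volume : Measure ℝ)) :=
  LinearMap.ker (T a)

/-- The Gabor wavelet `f_{μ, v, ω}(x) = exp (-(x - μ)² / (2 v)) exp (i ω x)`, of variance `v`. -/
def gabor (μ v ω : ℝ) (x : ℝ) : ℂ :=
  (Real.exp (-(x - μ) ^ 2 / (2 * v)) : ℂ) * Complex.exp (Complex.I * x * ω)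

theorem integrable_gabor (μ : ℝ) {v : ℝ} (hv : 0 < v) (ω : ℝ) : Integrable (gabor μ v ω) := by
  have h := (integrable_exp_neg_mul_sq (b := 1 / (2 * v)) (by positivity)).comp_sub_right μ
  refine h.mono' (Continuous.aestronglyMeasurable (by unfold gabor; fun_prop))
    (Filter.Eventually.of_forall fun x => le_of_eq ?_)
  have h1 : Complex.I * (x : ℂ) * (ω : ℂ) = ((x * ω : ℝ) : ℂ) * Complex.I := by
    push_cast; ring
  rw [gabor, norm_mul, h1, Complex.norm_exp_ofReal_mul_I, mul_one, Complex.norm_real,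
    Real.norm_eq_abs, Real.abs_exp]
  congr 1
  ring

/-- The Gabor wavelets, as elements of `L¹(ℝ)`, of variance `a / (1 - a)` whose location `μ` and
frequency `ω` satisfy `z = (((1 - a) / √a) μ + i √a ω) / √2` for a complex zero `z` of `erf`. -/
def zeroGabors (a : ℝ) (ha : 0 < a) (ha1 : a < 1) : Set (Lp ℂ 1 (volume : Measure ℝ)) :=
  {g | ∃ μ ω : ℝ, ∃ z : ℂ, erf z = 0 ∧
    z = (((1 - a) / Real.sqrt a * μ : ℝ) + Complex.I * (Real.sqrt a * ω : ℝ)) / (Real.sqrt 2 : ℂ) ∧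
    g = (integrable_gabor μ (div_pos ha (sub_pos.2 ha1)) ω).toL1 (gabor μ (a / (1 - a)) ω)}

end LinearMedian

end

/-! Multiply a Gabor wavelet by `φ(y - x)` and complete the square in `x`. The variance `a / (1 -
a)` is the one that centres the quadratic part at `a y`, exactly where the sign jumps, so the
remaining complex shift `z` depends only on `μ` and `ω`, not on `y`. Hence `T_a[f](y)` is a multiple
of `∫ sign(u) exp(-(u - z)²) du = √π erf z` and vanishes for all `y` when `erf z = 0`
(`integral_sign_mul_exp_neg_sub_sq`, `integral_kernel_mul_gabor_eq_zero`).

There are infinitely many such `z`: the zeros are simple because `erf'` never vanishes, and if they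
were finite in number, growth of order two would force `F = P exp h` with `P` polynomial and `h'`
affine. Then `F' = exp(-z²)` becomes a polynomial identity that fails by degree
(`infinite_zeros_of_hasDerivAt_exp_neg_sq`). Finally, wavelets of a common variance are independent
because distinct exponentials are (`linearIndependent_gabor`). -/

namespace LinearMedian

/-! ### Entire functions of order two and zeros of primitives of `exp(-z²)` -/

open Polynomial Metric Filter Topology

/-- Dividing an entire function with finitely many zeros, all simple, by a polynomial leaves a
zero-free entire function, which obeys the same bound on large disks. -/
theorem exists_polynomial_mul_of_simple_zeros (B : ℝ → ℝ) (S : Finset ℂ) :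
    ∀ f : ℂ → ℂ, Differentiable ℂ f → (∀ z, f z = 0 ↔ z ∈ S) → (∀ z ∈ S, deriv f z ≠ 0) →
      (∀ᶠ R in atTop, ∀ z, ‖z‖ ≤ R → ‖f z‖ ≤ B R) →
      ∃ (P : ℂ[X]) (g : ℂ → ℂ), Differentiable ℂ g ∧ (∀ z, g z ≠ 0) ∧
        (∀ᶠ R in atTop, ∀ z, ‖z‖ ≤ R → ‖g z‖ ≤ B R) ∧ ∀ z, f z = P.eval z * g z := by
  induction S using Finset.induction_on with
  | empty =>
    intro f hf h0 _ hB
    exact ⟨1, f, hf, fun z hz => by simpa using (h0 z).1 hz, hB, by simp⟩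
  | insert a S ha ih =>
    intro f hf h0 hd hB
    have hfa : f a = 0 := (h0 a).2 (by simp)
    have hmul : ∀ z, f z = (z - a) * dslope f a z := fun z => by
      have := sub_smul_dslope f a z
      rwa [smul_eq_mul, hfa, sub_zero, eq_comm] at this
    have hg : Differentiable ℂ (dslope f a) := by
      rw [← differentiableOn_univ] at hf ⊢
      exact (Complex.differentiableOn_dslope univ_mem).2 hf
    have hz : ∀ z, dslope f a z = 0 ↔ z ∈ S := by
      intro z
      by_cases hza : z = a
      · subst hza
        simpa [ha] using hd z (by simp)
      · rw [← mul_right_inj' (sub_ne_zero.2 hza), ← hmul, mul_zero, h0]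
        simp [hza]
    have hgs : ∀ z ∈ S, deriv (dslope f a) z ≠ 0 := by
      intro z hzS h
      refine hd z (by simp [hzS]) ?_
      have h1 : HasDerivAt f (1 * dslope f a z + (z - a) * deriv (dslope f a) z) z := by
        have := ((hasDerivAt_id z).sub_const a).mul (hg z).hasDerivAt
        exact this.congr_of_eventuallyEq (Eventually.of_forall hmul)
      rw [h1.deriv, (hz z).2 hzS, h]
      simp
    have hgb : ∀ᶠ R in atTop, ∀ z, ‖z‖ ≤ R → ‖dslope f a z‖ ≤ B R := by
      -- For `R ≥ ‖a‖ + 1` the factor `w - a` has modulus at least 1 on the circle, so division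
      -- keeps the bound there; the maximum principle carries it inside.
      filter_upwards [hB, eventually_ge_atTop (‖a‖ + 1)] with R hR hRa
      have hR0 : R ≠ 0 := by linarith [norm_nonneg a]
      intro z hz'
      refine Complex.norm_le_of_forall_mem_frontier_norm_le (U := ball 0 R) isBounded_ball
        hg.diffContOnCl ?_ (by rwa [closure_ball _ hR0, mem_closedBall_zero_iff])
      intro w hw
      rw [frontier_ball _ hR0, mem_sphere_zero_iff_norm] at hw
      have h1 : 1 ≤ ‖w - a‖ := by linarith [norm_sub_norm_le w a]
      calc ‖dslope f a w‖ ≤ ‖w - a‖ * ‖dslope f a w‖ :=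
            le_mul_of_one_le_left (norm_nonneg _) h1
        _ = ‖f w‖ := by rw [hmul w, norm_mul]
        _ ≤ B R := hR w hw.le
    obtain ⟨P, g, hgd, hg0, hgB, hP⟩ := ih (dslope f a) hg hz hgs hgb
    refine ⟨(X - C a) * P, g, hgd, hg0, hgB, fun z => ?_⟩
    rw [hmul, hP]
    simp [mul_assoc]

/-- A zero-free entire function is the exponential of an entire function. -/
theorem exists_eq_exp_of_forall_ne_zero {g : ℂ → ℂ} (hg : Differentiable ℂ g)
    (h0 : ∀ z, g z ≠ 0) : ∃ h : ℂ → ℂ, Differentiable ℂ h ∧ ∀ z, g z = Complex.exp (h z) := by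
  have hg' : Differentiable ℂ (deriv g) := hg.deriv
  -- `h` is a primitive of `g' / g`, so `g exp(-h)` is constant.
  obtain ⟨h, hh0, hh⟩ := ((hg'.div hg h0).isExactOn_univ).with_val_at 0 (Complex.log (g 0))
  have hd : ∀ z, HasDerivAt (fun z => g z * Complex.exp (-h z)) 0 z := fun z => by
    refine ((hg z).hasDerivAt.mul (hh z (Set.mem_univ z)).neg.cexp).congr_deriv ?_
    have := h0 z
    simp only [Pi.div_apply]
    field_simp
    ring
  refine ⟨h, fun z => (hh z (Set.mem_univ z)).differentiableAt, fun z => ?_⟩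
  have h1 := is_const_of_deriv_eq_zero (fun z => (hd z).differentiableAt) (fun z => (hd z).deriv) z 0
  simp only [hh0, Complex.exp_neg, Complex.exp_log (h0 0), mul_inv_cancel₀ (h0 0)] at h1
  field_simp at h1
  exact h1

/-- The derivative of an entire function whose real part grows at most quadratically is affine. -/
theorem exists_deriv_eq_affine_of_re_le {h : ℂ → ℂ} (hh : Differentiable ℂ h) {K : ℝ} (hK : 0 < K)
    (hre : ∀ᶠ R in atTop, ∀ z, ‖z‖ ≤ R → (h z).re ≤ K * R ^ 2) :
    ∃ α β : ℂ, ∀ z, deriv h z = α * z + β := by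
  -- Borel–Carathéodory on the disk of radius `2R`: for `‖z‖ ≤ R` its factors satisfy `‖z‖ / (2R -
  -- ‖z‖) ≤ 1` and `(2R + ‖z‖) / (2R - ‖z‖) ≤ 3`.
  have hbd : ∀ᶠ R in atTop, ∀ z, ‖z‖ ≤ R → ‖h z‖ ≤ 8 * K * R ^ 2 + 3 * ‖h 0‖ := by
    filter_upwards [(tendsto_id.const_mul_atTop (by norm_num : (0 : ℝ) < 2)).eventually hre,
      eventually_gt_atTop 0] with R hR hR0 z hz
    have h2 : ‖z‖ < 2 * R := by linarith
    have := Complex.borelCaratheodory (f := h) (M := K * (2 * R) ^ 2) (R := 2 * R) (z := z)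
      (by positivity) hh.differentiableOn
      (fun w hw => hR w (mem_ball_zero_iff.1 hw).le) (by positivity) (mem_ball_zero_iff.2 h2)
    refine this.trans (add_le_add ?_ ?_)
    · rw [div_le_iff₀ (by linarith)]
      have : 0 ≤ K * R ^ 2 := by positivity
      nlinarith [norm_nonneg z]
    · rw [div_le_iff₀ (by linarith)]
      nlinarith [norm_nonneg (h 0)]
  -- Cauchy's estimate on the circle of radius `R ≥ ‖c‖` about `c`, inside the disk of radius `2R`:
  -- `3! · O(R²) / R³ → 0`.
  have h3 : ∀ c, iteratedDeriv 3 h c = 0 := by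
    intro c
    have hlim : Tendsto (fun R : ℝ => 6 * (32 * K + 3 * ‖h 0‖) / R) atTop (𝓝 0) :=
      tendsto_const_nhds.div_atTop tendsto_id
    refine norm_le_zero_iff.1 (ge_of_tendsto hlim ?_)
    filter_upwards [(tendsto_id.const_mul_atTop (by norm_num : (0 : ℝ) < 2)).eventually hbd,
      eventually_ge_atTop 1, eventually_ge_atTop ‖c‖] with R hR hR1 hRc
    have hR0 : 0 < R := by linarith
    have := Complex.norm_iteratedDeriv_le_of_forall_mem_sphere_norm_le
      (C := (32 * K + 3 * ‖h 0‖) * R ^ 2) 3 hR0 (hh.diffContOnCl (s := ball c R)) (fun z hz => by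
        rw [mem_sphere_iff_norm] at hz
        have h1 : ‖z‖ ≤ 2 * R := by linarith [norm_le_norm_sub_add z c]
        refine (hR z h1).trans ?_
        have : 1 ≤ R ^ 2 := one_le_pow₀ hR1
        simp only [id]
        nlinarith [norm_nonneg (h 0)])
    refine this.trans_eq ?_
    simp only [Nat.factorial]
    push_cast
    field_simp
  have hd1 : Differentiable ℂ (deriv h) := hh.deriv
  have hd2 : Differentiable ℂ (deriv (deriv h)) := hd1.deriv
  have e3 : ∀ z, deriv (deriv (deriv h)) z = 0 := fun z => by
    rw [← h3 z]
    simp [iteratedDeriv_succ, iteratedDeriv_zero]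
  have e2 : ∀ z, deriv (deriv h) z = deriv (deriv h) 0 := fun z =>
    is_const_of_deriv_eq_zero hd2 e3 z 0
  have hd : ∀ z, HasDerivAt (fun z => deriv h z - deriv (deriv h) 0 * z) 0 z := fun z => by
    refine ((hd1 z).hasDerivAt.sub ((hasDerivAt_id z).const_mul _)).congr_deriv ?_
    rw [e2 z]; simp
  refine ⟨deriv (deriv h) 0, deriv h 0, fun z => ?_⟩
  have := is_const_of_deriv_eq_zero (fun z => (hd z).differentiableAt) (fun z => (hd z).deriv) z 0
  simp only [mul_zero, sub_zero] at this
  rw [← this]; ring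

/-- A primitive of `exp (-z ^ 2)` has infinitely many zeros. -/
theorem infinite_zeros_of_hasDerivAt_exp_neg_sq {F : ℂ → ℂ}
    (hF : ∀ z, HasDerivAt F (Complex.exp (-z ^ 2)) z) : {z | F z = 0}.Infinite := by
  intro hfin
  have hFd : Differentiable ℂ F := fun z => (hF z).differentiableAt
  have hgrow : ∀ᶠ R in atTop, ∀ z, ‖z‖ ≤ R → ‖F z‖ ≤ Real.exp (2 * R ^ 2) := by
    filter_upwards [eventually_ge_atTop (0 : ℝ), eventually_ge_atTop ‖F 0‖] with R hR hR1 z hz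
    have h1 : ‖F z - F 0‖ ≤ Real.exp (R ^ 2) * ‖z - 0‖ := by
      refine (convex_closedBall (0 : ℂ) R).norm_image_sub_le_of_norm_hasDerivWithin_le
        (fun w _ => (hF w).hasDerivWithinAt) (fun w hw => ?_) (by simpa) (by simpa)
      rw [mem_closedBall_zero_iff] at hw
      rw [Complex.norm_exp]
      refine Real.exp_le_exp.2 ((Complex.re_le_norm _).trans ?_)
      rw [norm_neg, norm_pow]
      gcongr
    have h2 : ‖F z‖ ≤ ‖F z - F 0‖ + ‖F 0‖ := norm_le_norm_sub_add _ _
    have h3 : R ^ 2 + 1 ≤ Real.exp (R ^ 2) := Real.add_one_le_exp _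
    rw [sub_zero] at h1
    have h4 : Real.exp (2 * R ^ 2) = Real.exp (R ^ 2) * Real.exp (R ^ 2) := by
      rw [← Real.exp_add]; ring_nf
    rw [h4]
    have h5 : Real.exp (R ^ 2) * ‖z‖ ≤ Real.exp (R ^ 2) * R := by gcongr
    have h6 : R ≤ Real.exp (R ^ 2) * R := le_mul_of_one_le_left hR (by nlinarith)
    nlinarith [sq_nonneg (R - 1)]
  obtain ⟨P, g, hgd, hg0, hgB, hP⟩ := exists_polynomial_mul_of_simple_zeros
    (fun R => Real.exp (2 * R ^ 2)) hfin.toFinset F hFd (fun z => by simp)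
    (fun z _ => by rw [(hF z).deriv]; exact Complex.exp_ne_zero _) hgrow
  obtain ⟨h, hhd, hgh⟩ := exists_eq_exp_of_forall_ne_zero hgd hg0
  obtain ⟨α, β, hL⟩ := exists_deriv_eq_affine_of_re_le hhd two_pos (by
    filter_upwards [hgB] with R hR z hz
    have := hR z hz
    rwa [hgh, Complex.norm_exp, Real.exp_le_exp] at this)
  -- `F' = (P' + P h') exp h`, so `Q = exp(-z² - h)` has no zeros.
  set Q : ℂ[X] := derivative P + P * (C α * X + C β) with hQ
  have hQe : ∀ z, Q.eval z = Complex.exp (-z ^ 2 - h z) := fun z => by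
    have h1 : HasDerivAt F ((derivative P).eval z * Complex.exp (h z) +
        P.eval z * (Complex.exp (h z) * deriv h z)) z := by
      refine ((P.hasDerivAt z).mul (hhd z).hasDerivAt.cexp).congr_of_eventuallyEq ?_
      exact Eventually.of_forall fun w => by simp [hP w, hgh w]
    have h2 := (hF z).unique h1
    rw [Complex.exp_sub, h2, hQ, hL]
    field_simp
    simp
  have hdeg : Q.degree = 0 := by
    by_contra hne
    obtain ⟨z, hz⟩ := IsAlgClosed.exists_root Q hne
    rw [IsRoot.def, hQe] at hz
    exact Complex.exp_ne_zero _ hz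
  obtain ⟨k, hk⟩ : ∃ k, Q = C k := ⟨_, eq_C_of_degree_eq_zero hdeg⟩
  have hk0 : k ≠ 0 := by
    rintro rfl
    simp [hk] at hdeg
  -- `Q` is constant, so the exponent `-z² - h` has zero derivative.
  have hlin : ∀ z, α * z + β = -2 * z := fun z => by
    have h1 : HasDerivAt (fun z => Q.eval z)
        (Complex.exp (-z ^ 2 - h z) * (-(2 * z) - deriv h z)) z := by
      rw [funext hQe]
      refine HasDerivAt.cexp (HasDerivAt.sub ?_ (hhd z).hasDerivAt)
      simpa using! (hasDerivAt_pow 2 z).neg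
    have h2 := (Q.hasDerivAt z).unique h1
    rw [hk, derivative_C, eval_zero, eq_comm, mul_eq_zero, or_iff_right (Complex.exp_ne_zero _),
      hL] at h2
    linear_combination -h2
  have hβ : β = 0 := by simpa using hlin 0
  have hα : α = -2 := by simpa [hβ] using hlin 1
  have hP0 : P ≠ 0 := by
    rintro rfl
    rw [hk] at hQ
    simp [hk0] at hQ
  -- The left side has degree `deg P + 1`, the right side at most `max 0 (deg P - 1)`.
  have h1 : P * (C α * X + C β) = C k - derivative P := by rw [← hk, hQ]; ring
  have h2 : (P * (C α * X + C β)).natDegree = P.natDegree + 1 := by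
    rw [hβ, hα, C_0, add_zero, natDegree_mul hP0 (by simp), natDegree_C_mul_X _ (by norm_num)]
  have h3 := natDegree_sub_le (C k) (derivative P)
  rw [← h1, h2, natDegree_C] at h3
  have h4 := natDegree_derivative_le P
  omega

end LinearMedian

namespace LinearMedian

/-! ### The error function and signed Gaussian integrals -/

open Filter Topology Set

theorem erf_neg (z : ℂ) : erf (-z) = -erf z := by
  simp [erf]

theorem erf_eq_of_hasDerivAt {F : ℂ → ℂ} (hF : ∀ z, HasDerivAt F (Complex.exp (-z ^ 2)) z)
    (h0 : F 0 = 0) (z : ℂ) : erf z = 2 / (Real.sqrt Real.pi : ℂ) * F z := by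
  have h : ∫ t in (0 : ℝ)..1, Complex.exp (-((t : ℂ) * z) ^ 2) * z = F z := by
    have := intervalIntegral.integral_eq_sub_of_hasDerivAt (a := 0) (b := 1)
      (f := fun t : ℝ => F (t * z)) (f' := fun t : ℝ => Complex.exp (-((t : ℂ) * z) ^ 2) * z)
      (fun t _ => by
        have h1 : HasDerivAt (fun t : ℝ => (t : ℂ) * z) z t := by
          simpa using (Complex.ofRealCLM.hasDerivAt (x := t)).mul_const z
        exact (hF (t * z)).comp t h1)
      (Continuous.intervalIntegrable (by fun_prop) _ _)
    simpa [h0] using this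
  rw [erf, h]

theorem hasDerivAt_erf (z : ℂ) :
    HasDerivAt erf (2 / (Real.sqrt Real.pi : ℂ) * Complex.exp (-z ^ 2)) z := by
  obtain ⟨F, h0, hF⟩ := ((by fun_prop : Differentiable ℂ fun z : ℂ =>
    Complex.exp (-z ^ 2)).isExactOn_univ).with_val_at 0 0
  rw [funext (erf_eq_of_hasDerivAt (fun z => hF z (mem_univ z)) h0)]
  exact (hF z (mem_univ z)).const_mul _

/-- The error function has infinitely many complex zeros. -/
theorem infinite_zeros_erf : {z | erf z = 0}.Infinite := by
  have hpi := (Real.sqrt_pos.2 Real.pi_pos).ne'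
  have hc : (2 / (Real.sqrt Real.pi : ℂ)) ≠ 0 := by simpa using hpi
  have := infinite_zeros_of_hasDerivAt_exp_neg_sq
    (F := fun z => (2 / (Real.sqrt Real.pi : ℂ))⁻¹ * erf z) (fun z => by
      have := (hasDerivAt_erf z).const_mul (2 / (Real.sqrt Real.pi : ℂ))⁻¹
      rwa [inv_mul_cancel_left₀ hc] at this)
  simpa [hpi] using this

theorem integrable_exp_neg_sub_sq (z : ℂ) :
    Integrable fun u : ℝ => Complex.exp (-((u : ℂ) - z) ^ 2) := by
  have := integrable_cexp_quadratic (b := 1) (by norm_num) (2 * z) (-z ^ 2)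
  refine this.congr (Eventually.of_forall fun u => ?_)
  simp only
  ring_nf

/-- Mean value inequality on the disk of radius `‖z‖` about `u`, where `erf'` is exponentially
small. Only this difference is needed, not the limit of `erf` itself. -/
theorem tendsto_erf_sub_sub_erf_add (z : ℂ) :
    Tendsto (fun u : ℝ => erf (u - z) - erf (u + z)) atTop (𝓝 0) := by
  set c : ℂ := 2 / (Real.sqrt Real.pi : ℂ)
  have hlim : Tendsto (fun u : ℝ => ‖c‖ * Real.exp (‖z‖ ^ 2 - (u - ‖z‖) ^ 2) * ‖2 * z‖) atTop
      (𝓝 0) := by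
    have h1 : Tendsto (fun u : ℝ => ‖z‖ ^ 2 - (u - ‖z‖) ^ 2) atTop atBot :=
      tendsto_atBot_add_const_left _ _ (tendsto_neg_atTop_atBot.comp
        ((tendsto_pow_atTop two_ne_zero).comp (tendsto_atTop_add_const_right _ _ tendsto_id)))
    simpa using ((Real.tendsto_exp_atBot.comp h1).const_mul ‖c‖).mul_const ‖2 * z‖
  refine squeeze_zero_norm' ?_ hlim
  filter_upwards [eventually_ge_atTop ‖z‖] with u hu
  have h := (convex_closedBall (u : ℂ) ‖z‖).norm_image_sub_le_of_norm_hasDerivWithin_le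
    (f := erf) (C := ‖c‖ * Real.exp (‖z‖ ^ 2 - (u - ‖z‖) ^ 2)) (x := u + z) (y := u - z)
    (fun w _ => (hasDerivAt_erf w).hasDerivWithinAt) (fun w hw => ?_) (by simp) (by simp)
  · rwa [show (u : ℂ) - z - (u + z) = -(2 * z) by ring, norm_neg] at h
  · rw [mem_closedBall_iff_norm] at hw
    rw [norm_mul, Complex.norm_exp]
    have hre : |w.re - u| ≤ ‖z‖ := by
      simpa using (Complex.abs_re_le_norm (w - u)).trans hw
    have him : |w.im| ≤ ‖z‖ := by
      simpa using (Complex.abs_im_le_norm (w - u)).trans hw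
    have h2 : (-w ^ 2).re = w.im ^ 2 - w.re ^ 2 := by
      simp [pow_two]
    rw [h2]
    have h3 : w.im ^ 2 ≤ ‖z‖ ^ 2 := sq_le_sq' (abs_le.1 him).1 (abs_le.1 him).2
    have h4 : u - ‖z‖ ≤ w.re := by linarith [(abs_le.1 hre).1]
    have h5 : (u - ‖z‖) ^ 2 ≤ w.re ^ 2 := pow_le_pow_left₀ (by linarith) h4 2
    gcongr

/-- The signed Gaussian integral about a complex centre is `√π erf`. -/
theorem integral_sign_mul_exp_neg_sub_sq (z : ℂ) :
    ∫ u : ℝ, (Real.sign u : ℂ) * Complex.exp (-((u : ℂ) - z) ^ 2) =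
      (Real.sqrt Real.pi : ℂ) * erf z := by
  set k : ℝ → ℂ := fun u => Complex.exp (-((u : ℂ) - z) ^ 2) with hk
  set s : ℂ := (Real.sqrt Real.pi : ℂ) with hs
  have hs0 : s ≠ 0 := by
    simpa [hs] using (Real.sqrt_pos.2 Real.pi_pos).ne'
  have hki : Integrable k := integrable_exp_neg_sub_sq z
  have h1 : ∫ u in Ioi (0 : ℝ), (Real.sign u : ℂ) * k u = ∫ u in Ioi (0 : ℝ), k u :=
    setIntegral_congr_fun measurableSet_Ioi fun u hu => by simp [Real.sign_of_pos hu]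
  have h2 : ∫ u in Iio (0 : ℝ), (Real.sign u : ℂ) * k u = ∫ u in Iio (0 : ℝ), -k u :=
    setIntegral_congr_fun measurableSet_Iio fun u hu => by simp [Real.sign_of_neg hu]
  have h3 : ∫ u in Iio (0 : ℝ), k u = ∫ u in Ioi (0 : ℝ), k (-u) := by
    rw [integral_comp_neg_Ioi, neg_zero, integral_Iic_eq_integral_Iio]
  have hsi : Integrable fun u : ℝ => (Real.sign u : ℂ) * k u := by
    have hm : Measurable Real.sign := by
      unfold Real.sign
      exact Measurable.ite measurableSet_Iio measurable_const
        (Measurable.ite measurableSet_Ioi measurable_const measurable_const)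
    refine hki.bdd_mul (c := 1) (Complex.measurable_ofReal.comp hm).aestronglyMeasurable
      (Eventually.of_forall fun u => ?_)
    rcases Real.sign_apply_eq u with h | h | h <;> simp [h]
  -- Folding the integral onto the positive half-line gives the integrand `k u - k (-u)`. This
  -- primitive vanishes at infinity, and oddness of `erf` makes its value at 0 equal to `-s erf z`.
  have hderiv : ∀ u : ℝ, HasDerivAt (fun u : ℝ => s / 2 * (erf (u - z) - erf (u + z)))
      (k u - k (-u)) u := fun u => by
    have e1 : HasDerivAt (fun u : ℝ => (u : ℂ) - z) 1 u :=
      (Complex.ofRealCLM.hasDerivAt (x := u)).sub_const z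
    have e2 : HasDerivAt (fun u : ℝ => (u : ℂ) + z) 1 u :=
      (Complex.ofRealCLM.hasDerivAt (x := u)).add_const z
    have := (((hasDerivAt_erf _).comp u e1).sub ((hasDerivAt_erf _).comp u e2)).const_mul (s / 2)
    refine this.congr_deriv ?_
    rw [hk, ← hs]
    simp only [Complex.ofReal_neg]
    rw [show (-(u : ℂ) - z) ^ 2 = (u + z) ^ 2 by ring]
    field_simp
  have h4 := integral_Ioi_of_hasDerivAt_of_tendsto (a := 0)
    (hderiv 0).continuousAt.continuousWithinAt (fun u _ => hderiv u)
    (hki.sub hki.comp_neg).integrableOn ((tendsto_erf_sub_sub_erf_add z).const_mul (s / 2))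
  rw [← integral_add_compl measurableSet_Ioi hsi (s := Ioi (0 : ℝ)), compl_Ioi,
    integral_Iic_eq_integral_Iio, h1, h2, integral_neg, h3, ← sub_eq_add_neg,
    ← integral_sub hki.integrableOn hki.comp_neg.integrableOn, h4]
  simp only [Complex.ofReal_zero, zero_sub, zero_add, erf_neg]
  ring

theorem sign_mul_of_pos {s : ℝ} (hs : 0 < s) (u : ℝ) : Real.sign (s * u) = Real.sign u := by
  rcases lt_trichotomy u 0 with h | rfl | h
  · rw [Real.sign_of_neg h, Real.sign_of_neg (mul_neg_of_pos_of_neg hs h)]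
  · simp
  · rw [Real.sign_of_pos h, Real.sign_of_pos (mul_pos hs h)]

theorem integral_sign_sub_mul_exp_eq_zero {z : ℂ} (hz : erf z = 0) {s : ℝ} (hs : 0 < s) (b : ℝ) :
    ∫ x : ℝ, (Real.sign (x - b) : ℂ) * Complex.exp (-((s : ℂ) * (x - b) - z) ^ 2) = 0 := by
  have h1 := integral_sub_right_eq_self (μ := volume)
    (fun u : ℝ => (Real.sign u : ℂ) * Complex.exp (-((s : ℂ) * u - z) ^ 2)) b
  have h2 := Measure.integral_comp_mul_left
    (fun u : ℝ => (Real.sign u : ℂ) * Complex.exp (-((u : ℂ) - z) ^ 2)) s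
  rw [integral_sign_mul_exp_neg_sub_sq, hz, mul_zero, smul_zero] at h2
  simp only [sign_mul_of_pos hs, Complex.ofReal_mul] at h2
  simpa only [h2, Complex.ofReal_sub] using h1

/-- A zero of `erf` makes the corresponding Gabor wavelet annihilated by the kernel. -/
theorem integral_kernel_mul_gabor_eq_zero {a : ℝ} (ha : 0 < a) (ha1 : a < 1) {μ ω : ℝ} {z : ℂ}
    (hz : erf z = 0)
    (h : z = (((1 - a) / Real.sqrt a * μ : ℝ) + Complex.I * (Real.sqrt a * ω : ℝ)) /
      (Real.sqrt 2 : ℂ)) (y : ℝ) :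
    ∫ x : ℝ, (kernel a x y : ℂ) * gabor μ (a / (1 - a)) ω x = 0 := by
  set r : ℝ := Real.sqrt a with hr
  set q : ℝ := Real.sqrt 2 with hq
  have hr0 : 0 < r := Real.sqrt_pos.2 ha
  have hq0 : 0 < q := Real.sqrt_pos.2 two_pos
  have har : a = r ^ 2 := (Real.sq_sqrt ha.le).symm
  have hq2 : q ^ 2 = 2 := Real.sq_sqrt zero_le_two
  have hb : (1 - a) ≠ 0 := by linarith
  have hrC : (r : ℂ) ≠ 0 := by exact_mod_cast hr0.ne'
  have hqC : (q : ℂ) ≠ 0 := by exact_mod_cast hq0.ne'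
  have hq2C : (q : ℂ) ^ 2 = 2 := by exact_mod_cast hq2
  have harC : (a : ℂ) = (r : ℂ) ^ 2 := by exact_mod_cast har
  have hbC : (1 - (a : ℂ)) ≠ 0 := by exact_mod_cast hb
  -- With `s = 1 / √(2a)`, these two identities match the coefficients of `(x - a y)²` and `x - a y`
  -- in `-(s (x - a y) - z)²` with those of the exponent of kernel times wavelet.
  have hs2 : (1 / ((q : ℂ) * r)) ^ 2 = 1 / (2 * a) := by
    rw [div_pow, mul_pow, hq2C, ← harC, one_pow]
  have hsz : 2 * (1 / ((q : ℂ) * r)) * z = (1 - a) * μ / a + Complex.I * ω := by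
    rw [h, harC]
    push_cast
    field_simp
    rw [hq2C, harC]
    ring
  have haC : (a : ℂ) ≠ 0 := by exact_mod_cast ha.ne'
  have key : ∀ x : ℝ, (kernel a x y : ℂ) * gabor μ (a / (1 - a)) ω x =
      ((Real.sqrt (2 * Real.pi) : ℂ)⁻¹ * Complex.exp (z ^ 2 + (a - 1) * y ^ 2 / 2 +
        (1 - a) * μ * y - (1 - a) * μ ^ 2 / (2 * a) + Complex.I * a * ω * y)) *
      ((Real.sign (x - a * y) : ℂ) *
        Complex.exp (-(((1 / (q * r) : ℝ) : ℂ) * (x - (a * y : ℝ)) - z) ^ 2)) := fun x => by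
    rw [kernel, gabor, ProbabilityTheory.gaussianPDFReal]
    simp only [NNReal.coe_one, mul_one, Complex.ofReal_mul, Complex.ofReal_exp]
    have hfac : ∀ A S E₁ E₂ E₃ E₄ E₅ : ℂ, E₁ * E₂ * E₃ = E₄ * E₅ →
        S * (A * E₁) * (E₂ * E₃) = A * E₄ * (S * E₅) := fun A S E₁ E₂ E₃ E₄ E₅ h => by
      linear_combination S * A * h
    rw [Complex.ofReal_inv]
    refine hfac _ _ _ _ _ _ _ ?_
    rw [← Complex.exp_add, ← Complex.exp_add, ← Complex.exp_add]
    congr 1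
    push_cast
    linear_combination (norm := skip) ((x : ℂ) - a * y) ^ 2 * hs2 - (x - a * y) * hsz
    field_simp
    ring
  simp_rw [key]
  rw [integral_const_mul, integral_sign_sub_mul_exp_eq_zero hz (by positivity), mul_zero]

theorem span_zeroGabors_le (a : ℝ) (ha : 0 < a) (ha1 : a < 1) :
    Submodule.span ℂ (zeroGabors a ha ha1) ≤ nullSpace a := by
  rw [Submodule.span_le]
  rintro g ⟨μ, ω, z, hz, h, rfl⟩
  refine LinearMap.mem_ker.2 (funext fun y => ?_)
  refine Eq.trans (integral_congr_ae ?_) (integral_kernel_mul_gabor_eq_zero ha ha1 hz h y)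
  filter_upwards [Integrable.coeFn_toL1 (integrable_gabor μ (div_pos ha (sub_pos.2 ha1)) ω)]
    with x hx
  rw [hx]

/-! ### Linear independence and infinite dimension -/

/-- Dedekind's independence of characters; the derivative at 0 recovers `l`, so the characters are
distinct. -/
theorem linearIndependent_exp_mul :
    LinearIndependent ℂ fun (l : ℂ) (x : ℝ) => Complex.exp (l * x) := by
  let χ : ℂ → Multiplicative ℝ →* ℂ := fun l =>
    { toFun := fun x => Complex.exp (l * (Multiplicative.toAdd x : ℝ))
      map_one' := by simp
      map_mul' := fun x y => by simp [mul_add, Complex.exp_add] }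
  have hχ : Function.Injective χ := fun l m h => by
    have hd : ∀ l : ℂ, HasDerivAt (fun x : ℝ => Complex.exp (l * x)) l 0 := fun l => by
      simpa using ((Complex.ofRealCLM.hasDerivAt (x := 0)).const_mul l).cexp
    have he : (fun x : ℝ => Complex.exp (l * x)) = fun x : ℝ => Complex.exp (m * x) :=
      funext fun x => DFunLike.congr_fun h (Multiplicative.ofAdd x)
    exact (hd l).unique (he ▸ hd m)
  exact (linearIndependent_monoidHom (Multiplicative ℝ) ℂ).comp χ hχ

/-- Gabor wavelets of a common variance, indexed by distinct locations and frequencies, are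
linearly independent in `L¹(ℝ)`. -/
theorem linearIndependent_gabor {v : ℝ} (hv : 0 < v) :
    LinearIndependent ℂ fun p : ℝ × ℝ =>
      (integrable_gabor p.1 hv p.2).toL1 (gabor p.1 v p.2) := by
  have hinj : Function.Injective fun p : ℝ × ℝ => ((p.1 / v : ℝ) : ℂ) + (p.2 : ℝ) * Complex.I := by
    rintro ⟨μ, ω⟩ ⟨μ', ω'⟩ h
    have h1 := congrArg Complex.re h
    have h2 := congrArg Complex.im h
    simp [hv.ne'] at h1 h2
    simp [h1, h2]
  have hexp := linearIndependent_exp_mul.comp _ hinj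
  rw [linearIndependent_iff'] at hexp ⊢
  intro s c hc p hp
  have hae : (fun x => ∑ p ∈ s, c p * gabor p.1 v p.2 x) =ᵐ[volume] fun _ => (0 : ℂ) := by
    have h0 := Lp.coeFn_zero ℂ 1 (volume : Measure ℝ)
    rw [← hc] at h0
    have h1 := Lp.coeFn_finsetSum s fun p : ℝ × ℝ =>
      c p • (integrable_gabor p.1 hv p.2).toL1 (gabor p.1 v p.2)
    have h2 : ∀ᵐ x : ℝ, ∀ p ∈ s, (c p • (integrable_gabor p.1 hv p.2).toL1
        (gabor p.1 v p.2) : Lp ℂ 1 (volume : Measure ℝ)) x = c p * gabor p.1 v p.2 x := by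
      refine (ae_ball_iff s.countable_toSet).2 fun p _ => ?_
      filter_upwards [Lp.coeFn_smul (c p) ((integrable_gabor p.1 hv p.2).toL1 (gabor p.1 v p.2)),
        Integrable.coeFn_toL1 (integrable_gabor p.1 hv p.2)] with x h3 h4
      rw [h3, Pi.smul_apply, h4, smul_eq_mul]
    filter_upwards [h0, h1, h2] with x e0 e1 e2
    rw [e1] at e0
    rw [← Finset.sum_congr rfl e2]
    simpa using e0
  -- Continuity upgrades the a.e. relation to every `x`. Multiplying by `exp(x² / (2v))` then strips
  -- the common Gaussian, leaving exponentials with exponents `μ / v + iω` and coefficients scaled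
  -- by `exp(-μ² / (2v))`.
  have hall := (Continuous.ae_eq_iff_eq volume (by unfold gabor; fun_prop) continuous_const).1 hae
  have := hexp s (fun p => c p * Complex.exp (-(p.1 ^ 2 / (2 * v) : ℝ))) (funext fun x => ?_) p hp
  · simpa using this
  · have hx := congrFun hall x
    rw [← mul_right_inj' (Complex.exp_ne_zero (x ^ 2 / (2 * v) : ℝ)), mul_zero,
      Finset.mul_sum] at hx
    rw [Pi.zero_apply, ← hx, Finset.sum_apply]
    refine Finset.sum_congr rfl fun p _ => ?_
    have hvC : (v : ℂ) ≠ 0 := by exact_mod_cast hv.ne'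
    rw [gabor, Pi.smul_apply, smul_eq_mul, Complex.ofReal_exp, mul_left_comm, mul_assoc,
      ← Complex.exp_add, ← Complex.exp_add, Function.comp_apply, ← Complex.exp_add]
    congr 2
    push_cast
    field_simp
    ring

/-- The location and frequency of the Gabor wavelet attached to `z`. -/
noncomputable def gaborParam (a : ℝ) (z : ℂ) : ℝ × ℝ :=
  (Real.sqrt 2 * z.re * (Real.sqrt a / (1 - a)), Real.sqrt 2 * z.im / Real.sqrt a)

theorem eq_of_gaborParam {a : ℝ} (ha : 0 < a) (ha1 : a < 1) (z : ℂ) :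
    z = (((1 - a) / Real.sqrt a * (gaborParam a z).1 : ℝ) +
      Complex.I * (Real.sqrt a * (gaborParam a z).2 : ℝ)) / (Real.sqrt 2 : ℂ) := by
  have hr := (Real.sqrt_pos.2 ha).ne'
  have hq := (Real.sqrt_pos.2 two_pos).ne'
  have hb : 1 - a ≠ 0 := by linarith
  have h1 : (1 - a) / Real.sqrt a * (gaborParam a z).1 = Real.sqrt 2 * z.re := by
    rw [gaborParam]; field_simp
  have h2 : Real.sqrt a * (gaborParam a z).2 = Real.sqrt 2 * z.im := by
    rw [gaborParam]; field_simp
  have hqC : (Real.sqrt 2 : ℂ) ≠ 0 := by exact_mod_cast hq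
  rw [h1, h2, eq_div_iff hqC]
  push_cast
  linear_combination (-(Real.sqrt 2 : ℂ)) * Complex.re_add_im z

theorem linearIndependent_zeroGabors (a : ℝ) (ha : 0 < a) (ha1 : a < 1) :
    LinearIndependent ℂ fun g : zeroGabors a ha ha1 => (g : Lp ℂ 1 (volume : Measure ℝ)) := by
  refine (linearIndependent_gabor (div_pos ha (sub_pos.2 ha1))).linearIndepOn_id.mono ?_
  rintro g ⟨μ, ω, z, -, -, rfl⟩
  exact ⟨(μ, ω), rfl⟩

theorem infinite_zeroGabors (a : ℝ) (ha : 0 < a) (ha1 : a < 1) :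
    (zeroGabors a ha ha1).Infinite := by
  refine infinite_of_injOn_mapsTo (f := fun z => (integrable_gabor (gaborParam a z).1
    (div_pos ha (sub_pos.2 ha1)) (gaborParam a z).2).toL1 _) ?_ ?_ infinite_zeros_erf
  · intro z _ w _ h
    have := (linearIndependent_gabor (div_pos ha (sub_pos.2 ha1))).injective h
    rw [eq_of_gaborParam ha ha1 z, eq_of_gaborParam ha ha1 w, this]
  · exact fun z hz => ⟨_, _, z, hz, eq_of_gaborParam ha ha1 z, rfl⟩

end LinearMedian

theorem mainTheorem7 (a : ℝ) (ha : 0 < a) (ha1 : a < 1) :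
    ¬ FiniteDimensional ℂ (LinearMedian.nullSpace a) ∧
    (LinearMedian.zeroGabors a ha ha1).Infinite ∧
    Submodule.span ℂ (LinearMedian.zeroGabors a ha ha1) ≤ LinearMedian.nullSpace a := by
  have hle := LinearMedian.span_zeroGabors_le a ha ha1
  have hinf := LinearMedian.infinite_zeroGabors a ha ha1
  refine ⟨fun hfd => ?_, hinf, hle⟩
  have hspan : FiniteDimensional ℂ (Submodule.span ℂ (LinearMedian.zeroGabors a ha ha1)) :=
    Submodule.finiteDimensional_of_le hle
  have hli := LinearMedian.linearIndependent_zeroGabors a ha ha1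
  have : LinearIndependent ℂ fun g : LinearMedian.zeroGabors a ha ha1 =>
      (⟨g, hle (Submodule.subset_span g.2)⟩ : LinearMedian.nullSpace a) :=
    LinearIndependent.of_comp (LinearMedian.nullSpace a).subtype hli
  have hfin : Finite (LinearMedian.zeroGabors a ha ha1) := this.finite
  exact hinf (Set.toFinite _)
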